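/- Call a real Banach space $V$ \emph{Rosenthal} if it does not contain an isomorphic copy of $\ell_1$, i.e. if there is no continuous linear map $\ell_1 \to V$ that is a homeomorphism onto its image. Call a compact Hausdorff space $X$ \emph{weakly Radon--Nikod\'ym} (WRN) if there exist a Rosenthal Banach space $V$ and a topological embedding of $X$ into the dual $V^*$ equipped with its weak$^*$ topology (since the image of a compact space is bounded, it is equivalent to ask for an embedding into the dual unit ball $(B_{V^*}, w^*)$). \textbf{Theorem.} The Stone--\v{C}ech compactification $\beta\mathbb{N}$ of the discrete space $\mathbb{N}$ is not WRN. That is, for no real Banach space $V$ not containing an isomorphic copy of $\ell_1$ is there a topological embedding of $\beta\mathbb{N}$ into $(V^*, w^*)$. -/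

import Mathlib

/-!
The separable cube `2 ^ I`, with `I = 2 ^ ℕ` uncountable, is a continuous image of `βℕ`. Suppose a
compact space `X` maps onto such a cube and embeds into `(V*, w*)`. For each coordinate `i`, the
compact subsets of `X` over `1` and over `0` are separated by finitely many vectors of the unit ball
of `V` with rational gaps, and infinitely many coordinates share the same gaps. If `V` does not
contain `ℓ¹`, Rosenthal's dichotomy yields infinitely many of these coordinates along which, for
each gap, every point of `X` is eventually never below the gap or eventually never above it. Up to
finitely many coordinates, a point is then described by one of finitely many types, and two points
of the same type lie over `1` and `0` respectively at only finitely many coordinates. But some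
infinite family of points differs pairwise in this way at infinitely many coordinates.
-/

universe u v

/-- A real normed space (in practice a Banach space) `V` is *Rosenthal* if it contains no isomorphic
copy of `ℓ¹`, i.e. no continuous linear map `ℓ¹ → V` is a homeomorphism onto its image. -/
def IsRosenthalSpace (V : Type v) [NormedAddCommGroup V] [NormedSpace ℝ V] : Prop :=
  ¬ ∃ T : lp (fun _ : ℕ => ℝ) 1 →L[ℝ] V, Topology.IsEmbedding T

/-- A compact Hausdorff space `X` is *weakly Radon–Nikodým* (WRN) if it is homeomorphic to a
subspace of `(V*, weak*)` for some real Banach space `V` not containing `ℓ¹`. (The image of a compact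
space is automatically bounded, so after rescaling it lies in the dual unit ball.) The Banach space
ranges over the universe `v`. -/
def IsWRN (X : Type u) [TopologicalSpace X] [CompactSpace X] [T2Space X] : Prop :=
  ∃ (V : Type v) (_ : NormedAddCommGroup V) (_ : NormedSpace ℝ V) (_ : CompleteSpace V),
    IsRosenthalSpace V ∧ ∃ α : X → WeakDual ℝ V, Topology.IsEmbedding α

open Filter Set

theorem exists_infinite_almostSubset {M : ℕ → Set ℕ} (hM : Antitone M)
    (hinf : ∀ k, (M k).Infinite) : ∃ N ⊆ M 0, N.Infinite ∧ ∀ k, (N \ M k).Finite := by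
  obtain ⟨f, hf, hfM⟩ := extraction_forall_of_frequently
    fun k => Nat.frequently_atTop_iff_infinite.2 (hinf k)
  refine ⟨range f, ?_, infinite_range_of_injective hf.injective, fun k => ?_⟩
  · rintro _ ⟨i, rfl⟩
    exact hM (Nat.zero_le i) (hfM i)
  · refine ((finite_lt_nat k).image f).subset ?_
    rintro _ ⟨⟨i, rfl⟩, hi⟩
    exact ⟨i, not_le.1 fun hki => hi (hM hki (hfM i)), rfl⟩

theorem exists_infinite_subset_decided {κ : Type*} [Countable κ] {P : κ → Set ℕ → Prop}
    (hP : ∀ {k M N}, P k M → (N \ M).Finite → P k N) {M₀ : Set ℕ} (hM₀ : M₀.Infinite) :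
    ∃ M ⊆ M₀, M.Infinite ∧ ∀ k, P k M ∨ ∀ N ⊆ M, N.Infinite → ¬ P k N := by
  cases isEmpty_or_nonempty κ
  · exact ⟨M₀, Subset.rfl, hM₀, isEmptyElim⟩
  obtain ⟨g, hg⟩ := exists_surjective_nat κ
  have shrink (k : κ) (M : {M : Set ℕ // M.Infinite}) : ∃ M' : {M : Set ℕ // M.Infinite},
      M'.1 ⊆ M.1 ∧ (P k M' ∨ ∀ N ⊆ M.1, N.Infinite → ¬ P k N) := by
    by_cases h : ∃ N ⊆ M.1, N.Infinite ∧ P k N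
    · obtain ⟨N, hNM, hN, hPN⟩ := h
      exact ⟨⟨N, hN⟩, hNM, .inl hPN⟩
    · exact ⟨M, Subset.rfl, .inr fun N hNM hN hPN => h ⟨N, hNM, hN, hPN⟩⟩
  choose next next_subset hnext using shrink
  let M : ℕ → {M : Set ℕ // M.Infinite} := Nat.rec ⟨M₀, hM₀⟩ fun i => next (g i)
  obtain ⟨N, hNM₀, hN, hNM⟩ := exists_infinite_almostSubset (M := fun i => (M i).1)
    (antitone_nat_of_succ_le fun i => next_subset (g i) (M i)) fun i => (M i).2
  refine ⟨N, hNM₀, hN, fun k => ?_⟩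
  obtain ⟨i, rfl⟩ := hg k
  refine (hnext (g i) (M i)).imp (fun h => hP h (hNM (i + 1))) fun h N' hN'N hN' hPN' => ?_
  have hfin : (N' \ (M i).1).Finite := (hNM i).subset (sdiff_subset_sdiff_left hN'N)
  refine h (N' ∩ (M i).1) inter_subset_right ?_ (hP hPN' ?_)
  · rw [← Set.sdiff_sdiff_right_self]
    exact hN'.sdiff hfin
  · rw [sdiff_eq_empty.2 inter_subset_left]
    exact finite_empty

theorem exists_notMem_forall_disjoint_insert {ι : Type*} [DecidableEq ι]
    {Q : Finset ι → Finset ι → Prop} {M : Set ι} (hM : M.Infinite)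
    (hinsert : ∀ A B, Q A B → {n ∈ M | ¬ (Q (insert n A) B ∧ Q A (insert n B))}.Finite)
    {J : Finset ι} (hJ : ∀ A B, A ⊆ J → B ⊆ J → Disjoint A B → Q A B) :
    ∃ n ∈ M, n ∉ J ∧ ∀ A B, A ⊆ insert n J → B ⊆ insert n J → Disjoint A B → Q A B := by
  have hbad : (⋃ p ∈ {p : Finset ι × Finset ι | p ∈ J.powerset ×ˢ J.powerset ∧ Q p.1 p.2},
      {n ∈ M | ¬ (Q (insert n p.1) p.2 ∧ Q p.1 (insert n p.2))}).Finite :=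
    ((J.powerset ×ˢ J.powerset).finite_toSet.subset fun p hp => hp.1).biUnion
      fun p hp => hinsert p.1 p.2 hp.2
  obtain ⟨n, hnM, hn⟩ := (hM.sdiff (hbad.union J.finite_toSet)).nonempty
  rw [mem_union, not_or] at hn
  refine ⟨n, hnM, hn.2, fun A B hA hB hAB => ?_⟩
  rw [Finset.subset_insert_iff] at hA hB
  have hAB' : Disjoint (A.erase n) (B.erase n) :=
    hAB.mono (Finset.erase_subset n A) (Finset.erase_subset n B)
  have hQ : Q (insert n (A.erase n)) (B.erase n) ∧ Q (A.erase n) (insert n (B.erase n)) := by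
    by_contra h
    exact hn.1 (mem_biUnion (x := (A.erase n, B.erase n))
      ⟨by simp [hA, hB], hJ _ _ hA hB hAB'⟩ ⟨hnM, h⟩)
  by_cases hnA : n ∈ A
  · rw [Finset.insert_erase hnA, Finset.erase_eq_of_notMem (Finset.disjoint_left.1 hAB hnA)] at hQ
    exact hQ.1
  by_cases hnB : n ∈ B
  · rw [Finset.insert_erase hnB, Finset.erase_eq_of_notMem hnA] at hQ
    exact hQ.2
  · simpa only [Finset.erase_eq_of_notMem hnA, Finset.erase_eq_of_notMem hnB] using
      hJ _ _ hA hB hAB'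

theorem exists_infinite_forall_disjoint {ι : Type*} [DecidableEq ι]
    {Q : Finset ι → Finset ι → Prop} {M : Set ι} (hM : M.Infinite) (hempty : Q ∅ ∅)
    (hinsert : ∀ A B, Q A B → {n ∈ M | ¬ (Q (insert n A) B ∧ Q A (insert n B))}.Finite) :
    ∃ J ⊆ M, J.Infinite ∧ ∀ A B : Finset ι, ↑A ⊆ J → ↑B ⊆ J → Disjoint A B → Q A B := by
  let 𝓕 : Set (Set ι) :=
    {J | J ⊆ M ∧ ∀ A B : Finset ι, ↑A ⊆ J → ↑B ⊆ J → Disjoint A B → Q A B}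
  have h𝓕 : Order.IsOfFiniteCharacter 𝓕 := fun J => by
    refine ⟨fun hJ K hKJ _ => ⟨hKJ.trans hJ.1, fun A B hA hB =>
      hJ.2 A B (hA.trans hKJ) (hB.trans hKJ)⟩, fun hJ => ⟨fun n hn => ?_, fun A B hA hB => ?_⟩⟩
    · exact (hJ {n} (singleton_subset_iff.2 hn) (finite_singleton n)).1 rfl
    · exact (hJ (A ∪ B) (union_subset hA hB) (A.finite_toSet.union B.finite_toSet)).2 A B
        subset_union_left subset_union_right
  obtain ⟨J, -, hJ⟩ := h𝓕.exists_maximal (x := ∅)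
    ⟨empty_subset M, fun A B hA hB _ => by
      rwa [Finset.coe_eq_empty.1 (subset_empty_iff.1 hA),
        Finset.coe_eq_empty.1 (subset_empty_iff.1 hB)]⟩
  refine ⟨J, hJ.prop.1, fun hJfin => ?_, hJ.prop.2⟩
  lift J to Finset ι using hJfin
  obtain ⟨n, hnM, hnJ, hn⟩ := exists_notMem_forall_disjoint_insert hM hinsert (J := J)
    fun A B hA hB => hJ.prop.2 A B (Finset.coe_subset.2 hA) (Finset.coe_subset.2 hB)
  refine hnJ (hJ.le_of_ge (y := insert n ↑J) ⟨insert_subset hnM hJ.prop.1, fun A B hA hB => ?_⟩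
    (subset_insert n _) (mem_insert n _))
  rw [← Finset.coe_insert, Finset.coe_subset] at hA hB
  exact hn A B hA hB

theorem exists_pairwise_disjoint_infinite_subsets {ι : Type*} {M : Set ι} (hM : M.Infinite) :
    ∃ D : ℕ → Set ι, Pairwise (Function.onFun Disjoint D) ∧ ∀ m, D m ⊆ M ∧ (D m).Infinite := by
  let f : ℕ → ι := fun i => hM.natEmbedding M i
  have hf : Function.Injective f :=
    Subtype.val_injective.comp (hM.natEmbedding M).injective
  refine ⟨fun m => range fun j => f (Nat.pair m j), fun m m' hne => disjoint_left.2 ?_,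
    fun m => ⟨?_, infinite_range_of_injective fun i j hij => (Nat.pair_eq_pair.1 (hf hij)).2⟩⟩
  · rintro _ ⟨i, rfl⟩ ⟨j, hij⟩
    exact hne (Nat.pair_eq_pair.1 (hf hij)).1.symm
  · rintro _ ⟨j, rfl⟩
    exact (hM.natEmbedding M _).2

theorem exists_infinite_preimage_singleton {I K : Type*} [Uncountable I] [Countable K]
    (κ : I → K) : ∃ c, (κ ⁻¹' {c}).Infinite := by
  by_contra! hfin
  refine not_countable_univ (α := I) ?_
  rw [← preimage_univ (f := κ), ← iUnion_of_singleton K, preimage_iUnion]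
  exact countable_iUnion fun c => (hfin c).countable

instance uncountable_pi_bool {I : Type*} [Infinite I] : Uncountable (I → Bool) := by
  rw [← Cardinal.aleph0_lt_mk_iff]
  exact (Cardinal.aleph0_le_mk I).trans_lt (by simpa using Cardinal.cantor (Cardinal.mk I))

section Rosenthal

variable {ι X : Type*} {L U : ι → Set X} {M : Set ι} {S : Set X}

/-- Convergence of a family of pairs of sets along `M`, on the points of `S`: no point of `S` lies
in both `L n` and `U n'` for infinitely many `n ∈ M` and infinitely many `n' ∈ M`. For
`L n = {f n < a}` and `U n = {b < f n}` it says that the values `f n x` do not oscillate across the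
gap `(a, b)`. -/
def PairsConvergeOn (L U : ι → Set X) (M : Set ι) (S : Set X) : Prop :=
  ∀ x ∈ S, {n ∈ M | x ∈ L n}.Finite ∨ {n ∈ M | x ∈ U n}.Finite

/-- Hereditary failure of `PairsConvergeOn`: passing to an infinite subset of `M` never produces
convergence on `S`. -/
def PairsOscillateOn (L U : ι → Set X) (M : Set ι) (S : Set X) : Prop :=
  ∀ N ⊆ M, N.Infinite → ¬ PairsConvergeOn L U N S

/-- The points lying in `L n` for `n ∈ A` and in `U n` for `n ∈ B`. -/
def pairCell (L U : ι → Set X) (A B : Finset ι) : Set X :=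
  (⋂ n ∈ A, L n) ∩ ⋂ n ∈ B, U n

/-- Independence of a family of pairs of sets: every finite choice of one set from each pair has a
common point. -/
def IndependentPairs (L U : ι → Set X) : Prop :=
  ∀ A B : Finset ι, Disjoint A B → (pairCell L U A B).Nonempty

theorem PairsConvergeOn.symm (h : PairsConvergeOn L U M S) : PairsConvergeOn U L M S :=
  fun x hx => (h x hx).symm

theorem PairsConvergeOn.of_finite_sdiff {N : Set ι} (h : PairsConvergeOn L U M S)
    (hN : (N \ M).Finite) : PairsConvergeOn L U N S := fun x hx => by
  have hsub (R : ι → Set X) : {n ∈ N | x ∈ R n} ⊆ {n ∈ M | x ∈ R n} ∪ N \ M :=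
    fun n ⟨hn, hx⟩ => (em (n ∈ M)).imp (⟨·, hx⟩) (⟨hn, ·⟩)
  exact (h x hx).imp (fun h => (h.union hN).subset (hsub L)) fun h => (h.union hN).subset (hsub U)

theorem PairsOscillateOn.symm (h : PairsOscillateOn L U M S) : PairsOscillateOn U L M S :=
  fun N hNM hN hconv => h N hNM hN hconv.symm

theorem PairsOscillateOn.nonempty (h : PairsOscillateOn L U M S) (hM : M.Infinite) :
    S.Nonempty := by
  by_contra hS
  exact h M Subset.rfl hM fun x hx => (hS ⟨x, hx⟩).elim

theorem PairsOscillateOn.finite_setOf_pairsConvergeOn_inter (h : PairsOscillateOn L U M S) :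
    {n ∈ M | PairsConvergeOn L U M (L n ∩ S)}.Finite := by
  by_contra hN
  refine h _ (sep_subset _ _) hN fun x hx => ?_
  by_cases hxL : ∃ n ∈ M, PairsConvergeOn L U M (L n ∩ S) ∧ x ∈ L n
  · obtain ⟨n, -, hconv, hxn⟩ := hxL
    exact (hconv x ⟨hxn, hx⟩).imp (fun hf => hf.subset fun i hi => ⟨hi.1.1, hi.2⟩)
      fun hf => hf.subset fun i hi => ⟨hi.1.1, hi.2⟩
  · exact .inl (finite_empty.subset fun n hn => hxL ⟨n, hn.1.1, hn.1.2, hn.2⟩)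

theorem mem_pairCell {A B : Finset ι} {x : X} :
    x ∈ pairCell L U A B ↔ (∀ n ∈ A, x ∈ L n) ∧ ∀ n ∈ B, x ∈ U n := by
  simp only [pairCell, mem_inter_iff, mem_iInter]

theorem pairCell_insert_left [DecidableEq ι] (A B : Finset ι) (n : ι) :
    pairCell L U (insert n A) B = L n ∩ pairCell L U A B := by
  simp only [pairCell, Finset.set_biInter_insert, inter_assoc]

theorem pairCell_insert_right [DecidableEq ι] (A B : Finset ι) (n : ι) :
    pairCell L U A (insert n B) = U n ∩ pairCell L U A B := by
  simp only [pairCell, Finset.set_biInter_insert, inter_left_comm]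

theorem pairCell_comp_embedding {κ : Type*} (f : κ ↪ ι) (A B : Finset κ) :
    pairCell (L ∘ f) (U ∘ f) A B = pairCell L U (A.map f) (B.map f) := by
  ext
  simp [mem_pairCell]

theorem exists_infinite_pairCell_nonempty {L U : ℕ → Set X} {M₀ : Set ℕ}
    (hM₀ : M₀.Infinite) (h : PairsOscillateOn L U M₀ univ) :
    ∃ J : Set ℕ, J.Infinite ∧ ∀ A B : Finset ℕ, ↑A ⊆ J → ↑B ⊆ J → Disjoint A B →
      (pairCell L U A B).Nonempty := by
  obtain ⟨M, hMM₀, hM, hdec⟩ := exists_infinite_subset_decided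
    (P := fun p : Finset ℕ × Finset ℕ => (PairsConvergeOn L U · (pairCell L U p.1 p.2)))
    PairsConvergeOn.of_finite_sdiff hM₀
  have hosc {A B : Finset ℕ} : ¬ PairsConvergeOn L U M (pairCell L U A B) →
      PairsOscillateOn L U M (pairCell L U A B) := (hdec (A, B)).resolve_left
  obtain ⟨J, -, hJ, hJosc⟩ := exists_infinite_forall_disjoint
    (Q := fun A B => PairsOscillateOn L U M (pairCell L U A B)) hM
    (fun N hN => by simpa [pairCell] using h N (hN.trans hMM₀)) fun A B hAB => by
      refine (hAB.finite_setOf_pairsConvergeOn_inter.union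
        hAB.symm.finite_setOf_pairsConvergeOn_inter).subset fun n ⟨hnM, hbad⟩ => ?_
      by_contra hn
      rw [mem_union, not_or] at hn
      refine hbad ⟨hosc fun hconv => hn.1 ⟨hnM, ?_⟩, hosc fun hconv => hn.2 ⟨hnM, ?_⟩⟩
      · rwa [pairCell_insert_left] at hconv
      · rw [pairCell_insert_right] at hconv
        exact hconv.symm
  exact ⟨J, hJ, fun A B hA hB hAB => (hJosc A B hA hB hAB).nonempty hM⟩

theorem exists_strictMono_independentPairs {L U : ℕ → Set X} {M : Set ℕ} (hM : M.Infinite)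
    (h : PairsOscillateOn L U M univ) :
    ∃ f : ℕ → ℕ, StrictMono f ∧ IndependentPairs (L ∘ f) (U ∘ f) := by
  obtain ⟨J, hJ, hind⟩ := exists_infinite_pairCell_nonempty hM h
  let f : ℕ ↪o ℕ := OrderEmbedding.ofStrictMono _ (Nat.nth_strictMono hJ)
  have hfJ (A : Finset ℕ) : ↑(A.map f.toEmbedding) ⊆ J := by
    rw [Finset.coe_map]
    rintro _ ⟨n, -, rfl⟩
    exact Nat.nth_mem_of_infinite hJ n
  refine ⟨f, f.strictMono, fun A B hAB => ?_⟩
  have hne := hind _ _ (hfJ A) (hfJ B) ((Finset.disjoint_map _).2 hAB)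
  rwa [← pairCell_comp_embedding] at hne

theorem exists_infinite_pairsConvergeOn {κ : Type*} [Countable κ] {L U : κ → ℕ → Set X}
    (h : ∀ k (f : ℕ → ℕ), StrictMono f → ¬ IndependentPairs (L k ∘ f) (U k ∘ f)) :
    ∃ M : Set ℕ, M.Infinite ∧ ∀ k, PairsConvergeOn (L k) (U k) M univ := by
  obtain ⟨M, -, hM, hdec⟩ := exists_infinite_subset_decided
    (P := fun k => (PairsConvergeOn (L k) (U k) · univ)) PairsConvergeOn.of_finite_sdiff
    infinite_univ
  refine ⟨M, hM, fun k => (hdec k).resolve_right fun hosc => ?_⟩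
  obtain ⟨f, hf, hind⟩ := exists_strictMono_independentPairs hM hosc
  exact h k f hf hind

theorem PairsConvergeOn.finite_setOf_mem_inter (h : PairsConvergeOn L U M univ) {x y : X}
    (hxy : {n ∈ M | x ∈ L n}.Finite ↔ {n ∈ M | y ∈ L n}.Finite) :
    {n ∈ M | x ∈ L n ∧ y ∈ U n}.Finite := by
  by_cases hx : {n ∈ M | x ∈ L n}.Finite
  · exact hx.subset fun n hn => ⟨hn.1, hn.2.1⟩
  · exact ((h y (mem_univ y)).resolve_left (hxy.not.1 hx)).subset fun n hn => ⟨hn.1, hn.2.2⟩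

theorem exists_forall_mem_notMem_of_pairsConvergeOn {κ : Type*} [Finite κ]
    {L U : κ → ι → Set X} {e : X → ι → Bool} (he : Function.Surjective e) (hM : M.Infinite)
    (hconv : ∀ k, PairsConvergeOn (L k) (U k) M univ) :
    ∃ n x y, e x n = true ∧ e y n = false ∧ ∀ k, x ∈ L k n → y ∉ U k n := by
  classical
  obtain ⟨D, hdisj, hD⟩ := exists_pairwise_disjoint_infinite_subsets hM
  choose x hx using fun m => he fun n => decide (n ∈ D m)
  obtain ⟨m, m', hne, htype⟩ := Finite.exists_ne_map_eq_of_infinite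
    fun m => {k | {n ∈ M | x m ∈ L k n}.Finite}
  have hfin (k : κ) : {n ∈ M | x m ∈ L k n ∧ x m' ∈ U k n}.Finite :=
    (hconv k).finite_setOf_mem_inter (Set.ext_iff.1 htype k)
  obtain ⟨n, hnD, hn⟩ := ((hD m).2.sdiff (finite_iUnion hfin)).nonempty
  have hnD' : n ∉ D m' := disjoint_left.1 (hdisj hne) hnD
  exact ⟨n, x m, x m', by simpa [hx] using hnD, by simpa [hx] using hnD',
    fun k hL hU => hn (mem_iUnion.2 ⟨k, (hD m).1 hnD, hL, hU⟩)⟩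

end Rosenthal

theorem hasSum_norm_lp_one {ι : Type*} {E : ι → Type*} [∀ i, NormedAddCommGroup (E i)]
    (c : lp E 1) : HasSum (fun i => ‖c i‖) ‖c‖ := by
  simpa using lp.hasSum_norm (p := 1) (by simp) c

theorem exists_clm_lp_one_hasSum {𝕜 V ι : Type*} [NontriviallyNormedField 𝕜]
    [NormedAddCommGroup V] [NormedSpace 𝕜 V] [CompleteSpace V] {v : ι → V} {C : ℝ}
    (hv : ∀ i, ‖v i‖ ≤ C) :
    ∃ T : lp (fun _ : ι => 𝕜) 1 →L[𝕜] V, ∀ c, HasSum (fun i => c i • v i) (T c) := by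
  have hle (c : lp (fun _ : ι => 𝕜) 1) (i : ι) : ‖c i • v i‖ ≤ ‖c i‖ * C := by
    rw [norm_smul]
    exact mul_le_mul_of_nonneg_left (hv i) (norm_nonneg _)
  have hbound (c : lp (fun _ : ι => 𝕜) 1) : HasSum (fun i => ‖c i‖ * C) (‖c‖ * C) :=
    (hasSum_norm_lp_one c).mul_right C
  have hsum (c : lp (fun _ : ι => 𝕜) 1) : Summable fun i => c i • v i :=
    .of_norm_bounded (hbound c).summable (hle c)
  let T : lp (fun _ : ι => 𝕜) 1 →ₗ[𝕜] V :=
    { toFun := fun c => ∑' i, c i • v i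
      map_add' := fun c d => by
        simp only [lp.coeFn_add, Pi.add_apply, add_smul, (hsum c).tsum_add (hsum d)]
      map_smul' := fun a c => by
        simp only [lp.coeFn_smul, Pi.smul_apply, smul_assoc, (hsum c).tsum_const_smul,
          RingHom.id_apply] }
  refine ⟨T.mkContinuous C fun c => ?_, fun c => (hsum c).hasSum⟩
  rw [mul_comm]
  exact tsum_of_norm_bounded (hbound c) (hle c)

theorem not_isRosenthalSpace_of_le_norm_sum {V : Type*} [NormedAddCommGroup V]
    [NormedSpace ℝ V] [CompleteSpace V] {v : ℕ → V} {C K : ℝ} (hv : ∀ n, ‖v n‖ ≤ C)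
    (h : ∀ (s : Finset ℕ) (c : ℕ → ℝ), ∑ n ∈ s, ‖c n‖ ≤ K * ‖∑ n ∈ s, c n • v n‖) :
    ¬ IsRosenthalSpace V := by
  obtain ⟨T, hT⟩ := exists_clm_lp_one_hasSum (𝕜 := ℝ) hv
  have hT_below (c : lp (fun _ : ℕ => ℝ) 1) : ‖c‖ ≤ K.toNNReal * ‖T c‖ :=
    le_of_tendsto_of_tendsto' (hasSum_norm_lp_one c) ((hT c).norm.const_mul _) fun s =>
      (h s c).trans (by gcongr; exact K.le_coe_toNNReal)
  have hT_anti : AntilipschitzWith K.toNNReal T :=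
    AddMonoidHomClass.antilipschitz_of_bound T hT_below
  exact not_not.2 ⟨T, (hT_anti.isUniformEmbedding T.uniformContinuous).isEmbedding⟩

theorem IndependentPairs.mul_sum_norm_le {ι X V : Type*} [SeminormedAddCommGroup V]
    [NormedSpace ℝ V] {φ : X → StrongDual ℝ V} {C : ℝ} (hφ : ∀ x, ‖φ x‖ ≤ C) {v : ι → V}
    {a b : ℝ} (h : IndependentPairs (fun i => {x | φ x (v i) < a}) fun i => {x | b < φ x (v i)})
    (s : Finset ι) (c : ι → ℝ) :
    (b - a) * ∑ i ∈ s, ‖c i‖ ≤ 2 * C * ‖∑ i ∈ s, c i • v i‖ := by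
  obtain ⟨x, hx⟩ := h _ _ (Finset.disjoint_filter_filter_not s s (c · < 0))
  obtain ⟨y, hy⟩ := h _ _ (Finset.disjoint_filter_filter_not s s (c · < 0)).symm
  simp only [mem_pairCell, Finset.mem_filter, not_lt, mem_ofPred_eq, and_imp] at hx hy
  have hterm (i : ι) (hi : i ∈ s) : (b - a) * ‖c i‖ ≤ c i * (φ x (v i) - φ y (v i)) := by
    rcases lt_or_ge (c i) 0 with hc | hc
    · rw [Real.norm_of_nonpos hc.le]
      nlinarith [hx.1 i hi hc, hy.2 i hi hc]
    · rw [Real.norm_of_nonneg hc]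
      nlinarith [hx.2 i hi hc, hy.1 i hi hc]
  calc (b - a) * ∑ i ∈ s, ‖c i‖
      ≤ ∑ i ∈ s, c i * (φ x (v i) - φ y (v i)) := by
        rw [Finset.mul_sum]
        exact Finset.sum_le_sum hterm
    _ = (φ x - φ y) (∑ i ∈ s, c i • v i) := by simp [map_sum]
    _ ≤ ‖φ x - φ y‖ * ‖∑ i ∈ s, c i • v i‖ := (le_abs_self _).trans ((φ x - φ y).le_opNorm _)
    _ ≤ 2 * C * ‖∑ i ∈ s, c i • v i‖ := by
        gcongr
        linarith [norm_sub_le (φ x) (φ y), hφ x, hφ y]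

theorem not_isRosenthalSpace_of_independentPairs {X V : Type*} [NormedAddCommGroup V]
    [NormedSpace ℝ V] [CompleteSpace V] {φ : X → StrongDual ℝ V} {C D : ℝ} (hφ : ∀ x, ‖φ x‖ ≤ C)
    {v : ℕ → V} (hv : ∀ n, ‖v n‖ ≤ D) {a b : ℝ} (hab : a < b)
    (h : IndependentPairs (fun n => {x | φ x (v n) < a}) fun n => {x | b < φ x (v n)}) :
    ¬ IsRosenthalSpace V := by
  refine not_isRosenthalSpace_of_le_norm_sum (K := 2 * C / (b - a)) hv fun s c => ?_
  rw [div_mul_eq_mul_div, le_div_iff₀' (sub_pos.2 hab)]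
  exact h.mul_sum_norm_le hφ s c

theorem exists_norm_le_one_apply_lt {V : Type*} [NormedAddCommGroup V] [NormedSpace ℝ V]
    {f g : StrongDual ℝ V} (hfg : f ≠ g) : ∃ v, ‖v‖ ≤ 1 ∧ f v < g v := by
  by_contra! hle
  refine hfg (sub_eq_zero.1 (norm_le_zero_iff.1 ?_))
  refine ContinuousLinearMap.opNorm_le_of_unit_norm le_rfl fun v hv => ?_
  have hneg := hle (-v) (by rw [norm_neg, hv])
  rw [map_neg, map_neg, neg_le_neg_iff] at hneg
  simp [hneg.antisymm (hle v hv.le)]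

theorem exists_finset_separating {V : Type*} [NormedAddCommGroup V] [NormedSpace ℝ V]
    {K₁ K₂ : Set (WeakDual ℝ V)} (h₁ : IsCompact K₁) (h₂ : IsCompact K₂) (h : Disjoint K₁ K₂) :
    ∃ (t : Finset (ℕ × ℚ × ℚ)) (v : ℕ → V), (∀ n, ‖v n‖ ≤ 1) ∧ (∀ p ∈ t, p.2.1 < p.2.2) ∧
      ∀ f ∈ K₁, ∀ g ∈ K₂, ∃ p ∈ t, f (v p.1) < p.2.1 ∧ p.2.2 < g (v p.1) := by
  classical
  let I := {p : V × ℚ × ℚ // ‖p.1‖ ≤ 1 ∧ p.2.1 < p.2.2}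
  let W (i : I) : Set (WeakDual ℝ V × WeakDual ℝ V) :=
    {f | f i.1.1 < (i.1.2.1 : ℝ)} ×ˢ {g | (i.1.2.2 : ℝ) < g i.1.1}
  have hW (i : I) : IsOpen (W i) :=
    (isOpen_lt (WeakDual.eval_continuous _) continuous_const).prod
      (isOpen_lt continuous_const (WeakDual.eval_continuous _))
  have hcover : K₁ ×ˢ K₂ ⊆ ⋃ i, W i := by
    rintro ⟨f, g⟩ ⟨hf, hg⟩
    obtain ⟨v, hv, hfg⟩ := exists_norm_le_one_apply_lt
      (f := WeakDual.toStrongDual f) (g := WeakDual.toStrongDual g) (h.ne_of_mem hf hg)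
    obtain ⟨p, hfp, hpg⟩ := exists_rat_btwn hfg
    obtain ⟨q, hpq, hqg⟩ := exists_rat_btwn hpg
    exact mem_iUnion.2 ⟨⟨(v, p, q), hv, Rat.cast_lt.1 hpq⟩, hfp, hqg⟩
  obtain ⟨s, hs⟩ := (h₁.prod h₂).elim_finite_subcover W hW hcover
  obtain ⟨code, hcode⟩ := exists_injective_nat s
  let v : ℕ → Metric.closedBall (0 : V) 1 :=
    Function.extend code (fun i => ⟨i.1.1.1, by simpa using i.1.2.1⟩) 0
  have hv (i : s) : (v (code i) : V) = i.1.1.1 := by simp [v, hcode.extend_apply]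
  refine ⟨s.attach.image fun i => (code i, i.1.1.2), fun n => v n,
    fun n => mem_closedBall_zero_iff.1 (v n).2, fun p hp => ?_, fun f hf g hg => ?_⟩
  · obtain ⟨i, -, rfl⟩ := Finset.mem_image.1 hp
    exact i.1.2.2
  · obtain ⟨i, hi, hfi, hgi⟩ := mem_iUnion₂.1 (hs (mk_mem_prod hf hg))
    refine ⟨_, Finset.mem_image_of_mem _ (Finset.mem_attach s ⟨i, hi⟩), ?_⟩
    simp only [hv]
    exact ⟨hfi, hgi⟩

theorem exists_forall_norm_toStrongDual_le {𝕜 V X : Type*} [NontriviallyNormedField 𝕜]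
    [NormedAddCommGroup V] [NormedSpace 𝕜 V] [CompleteSpace V] [TopologicalSpace X]
    [CompactSpace X] {α : X → WeakDual 𝕜 V} (hα : Continuous α) :
    ∃ C, ∀ x, ‖WeakDual.toStrongDual (α x)‖ ≤ C := by
  have h := WeakDual.isBounded_iff_isVonNBounded.2
    ((isCompact_range hα).isVonNBounded 𝕜)
  rw [← WeakDual.isBounded_toWeakDual_preimage_iff_isBounded] at h
  obtain ⟨C, hC⟩ := h.exists_norm_le
  exact ⟨C, fun x => hC _ ⟨x, rfl⟩⟩

instance separableSpace_pi_bool {Y : Type*} [TopologicalSpace Y] [CompactSpace Y] [T2Space Y]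
    [TotallyDisconnectedSpace Y] [SecondCountableTopology Y] :
    TopologicalSpace.SeparableSpace (Y → Bool) := by
  classical
  have : Countable (TopologicalSpace.Clopens Y) :=
    TopologicalSpace.Clopens.countable_iff_secondCountable.2 inferInstance
  let ind (c : TopologicalSpace.Clopens Y) (y : Y) : Bool := decide (y ∈ c)
  refine ⟨range ind, countable_range ind, fun τ => mem_closure_iff.2 fun O hO hτ => ?_⟩
  obtain ⟨F, u, hu, huO⟩ := isOpen_pi_iff.1 hO τ hτ
  obtain ⟨c, hc, htrue, hfalse⟩ := exists_clopen_of_closed_subset_open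
    (Z := {y ∈ (F : Set Y) | τ y = true}) (U := {y ∈ (F : Set Y) | τ y = false}ᶜ)
    (F.finite_toSet.subset (sep_subset _ _)).isClosed
    (F.finite_toSet.subset (sep_subset _ _)).isClosed.isOpen_compl
    (fun y hy hy' => by simp [hy.2] at hy')
  refine ⟨ind ⟨c, hc⟩, huO fun y hy => ?_, ⟨c, hc⟩, rfl⟩
  have hind : ind ⟨c, hc⟩ y = τ y := by
    cases hτy : τ y
    · exact decide_eq_false fun hyc => hfalse hyc ⟨hy, hτy⟩
    · exact decide_eq_true (htrue ⟨hy, hτy⟩)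
  rw [hind]
  exact (hu y hy).2

theorem exists_continuous_surjective_stoneCech_nat (Y : Type*) [TopologicalSpace Y]
    [CompactSpace Y] [T2Space Y] [TopologicalSpace.SeparableSpace Y] [Nonempty Y] :
    ∃ e : StoneCech ℕ → Y, Continuous e ∧ Function.Surjective e := by
  have hdense := TopologicalSpace.denseRange_denseSeq Y
  have hcont : Continuous (TopologicalSpace.denseSeq Y) := continuous_of_discreteTopology
  refine ⟨stoneCechExtend hcont, continuous_stoneCechExtend hcont, range_eq_univ.1 ?_⟩
  have hrange : DenseRange (stoneCechExtend hcont) := by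
    rw [← stoneCechExtend_extends hcont] at hdense
    exact hdense.of_comp
  rw [← hrange.closure_range,
    (isCompact_range (continuous_stoneCechExtend hcont)).isClosed.closure_eq]

theorem exists_nat_embedding_separating {V X I : Type*} [NormedAddCommGroup V] [NormedSpace ℝ V]
    [TopologicalSpace X] [CompactSpace X] [Uncountable I] {e : X → I → Bool} (he : Continuous e)
    {α : X → WeakDual ℝ V} (hα : Continuous α) (hinj : Function.Injective α) :
    ∃ (i : ℕ ↪ I) (t : Finset (ℕ × ℚ × ℚ)) (v : ℕ → ℕ → V), (∀ n j, ‖v n j‖ ≤ 1) ∧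
      (∀ p ∈ t, p.2.1 < p.2.2) ∧ ∀ n x y, e x (i n) = true → e y (i n) = false →
        ∃ p ∈ t, α x (v n p.1) < p.2.1 ∧ p.2.2 < α y (v n p.1) := by
  have hcompact (i : I) (b : Bool) : IsCompact (α '' {x | e x i = b}) :=
    (isClosed_eq ((continuous_apply i).comp he) continuous_const).isCompact.image hα
  have hdisj (i : I) : Disjoint (α '' {x | e x i = true}) (α '' {x | e x i = false}) :=
    (disjoint_image_iff hinj).2 (disjoint_left.2 fun x hx hx' => by simp_all)
  choose t v hv ht hsep using fun i =>
    exists_finset_separating (hcompact i true) (hcompact i false) (hdisj i)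
  obtain ⟨t₀, hinf⟩ := exists_infinite_preimage_singleton t
  let i : ℕ ↪ I := (hinf.natEmbedding _).trans (Function.Embedding.subtype _)
  have hi (n : ℕ) : t (i n) = t₀ := (hinf.natEmbedding _ n).2
  refine ⟨i, t₀, fun n => v (i n), fun n => hv (i n), hi 0 ▸ ht (i 0), fun n x y hx hy => ?_⟩
  rw [← hi n]
  exact hsep (i n) _ (mem_image_of_mem α hx) _ (mem_image_of_mem α hy)

theorem mainTheorem12_general {X : Type u} [TopologicalSpace X] [CompactSpace X] [T2Space X]
    {I : Type*} [Uncountable I] {e : X → I → Bool} (he : Continuous e)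
    (hsurj : Function.Surjective e) : ¬ IsWRN.{u, v} X := by
  rintro ⟨V, _, _, _, hV, α, hα⟩
  obtain ⟨C, hC⟩ := exists_forall_norm_toStrongDual_le hα.continuous
  obtain ⟨i, t, v, hv, ht, hsep⟩ := exists_nat_embedding_separating he hα.continuous hα.injective
  let L (p : t) (n : ℕ) : Set X := {x | α x (v n p.1.1) < p.1.2.1}
  let U (p : t) (n : ℕ) : Set X := {x | p.1.2.2 < α x (v n p.1.1)}
  obtain ⟨M, hM, hconv⟩ : ∃ M : Set ℕ, M.Infinite ∧ ∀ p, PairsConvergeOn (L p) (U p) M univ :=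
    exists_infinite_pairsConvergeOn fun p f _ hind =>
      not_isRosenthalSpace_of_independentPairs hC (fun n => hv (f n) p.1.1)
        (Rat.cast_lt.2 (ht p p.2)) hind hV
  obtain ⟨n, x, y, hx, hy, hxy⟩ := exists_forall_mem_notMem_of_pairsConvergeOn
    (i.injective.surjective_comp_right.comp hsurj) hM hconv
  obtain ⟨p, hp, hlt, hgt⟩ := hsep n x y hx hy
  exact hxy ⟨p, hp⟩ hlt hgt

/-- `βℕ` is not WRN (whatever the universe in which the Banach spaces live). -/
theorem mainTheorem12 : ¬ IsWRN.{0, v} (StoneCech ℕ) := by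
  obtain ⟨e, he, hsurj⟩ := exists_continuous_surjective_stoneCech_nat ((ℕ → Bool) → Bool)
  exact mainTheorem12_general he hsurj
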